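/- Let $n\in\mathbb N$, let $A\in\mathbb R^{n\times n}$ be Hurwitz, $B\in\mathbb R^n$, let $Q=Q^{\mathsf T}\succ0$, let $P=P^{\mathsf T}\succ 0$ satisfy $A^{\mathsf T}P+PA=-Q$, and put $C=PB$. Let $r:[0,\infty)\to\mathbb R$ be piecewise continuous (finitely many discontinuities in every bounded interval, finite one-sided limits) and bounded, and let $x_m:[0,\infty)\to\mathbb R^n$ be a solution of the reference model $\dot x_m(t)=Ax_m(t)+Br(t)$ (continuous, satisfying the equation at the points of continuity of $r$). Suppose that $x_m$ is bounded and persistently exciting: there are $T>0$ and $\alpha>0$ with $$\int_t^{t+T}x_m(\tau)x_m^{\mathsf T}(\tau)\,d\tau\succeq\alpha I\qquad\text{for all }t\ge 0 .$$ Consider the model reference adaptive control error dynamics for $z=[e^{\mathsf T},\phi^{\mathsf T}]^{\mathsf T}\in\mathbb R^{2n}$, $$\dot z(t)=\begin{bmatrix}A & Bx^{\mathsf T}(t)\\ -x(t)C^{\mathsf T} & 0\end{bmatrix}z(t),\qquad x(t)=x_m(t)+e(t).$$ Then $z=0$ is an equilibrium, for every $t_0\ge0$ and $z_0\in\mathbb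 R^{2n}$ there is a unique solution $s(t;z_0,t_0)$, $t\ge t_0$, with $s(t_0;z_0,t_0)=z_0$, and the equilibrium is uniformly asymptotically stable in the large (UASL); that is, in the Euclidean norm, 1. (uniformly stable) for every $\epsilon>0$ there is $\delta>0$ such that $\|z_0\|\le\delta$ implies $\|s(t;z_0,t_0)\|\le\epsilon$ for all $t_0\ge0$ and $t\ge t_0$; 2. (uniformly bounded) for every $\rho>0$ there is $b$ such that $\|z_0\|\le\rho$ implies $\|s(t;z_0,t_0)\|\le b$ for all $t_0\ge0$ and $t\ge t_0$; 3. (uniformly attracting in the large) for all $\rho>0$ and $\eta>0$ there is $T'\ge0$ such that $\|z_0\|\le\rho$ implies $\|s(t;z_0,t_0)\|\le\eta$ for all $t_0\ge0$ and $t\ge t_0+T'$. -/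

import Mathlib

open Set Filter Topology

/-! ### Stability of the equilibrium `0` of `x' = f(x, t)`, `t ≥ t₀ ≥ 0` -/

/-- `s` is a solution on `[t₀, ∞)` of `s' = f(s, t)` with `s(t₀) = x₀`
(the derivative at `t₀` is the right derivative). -/
def IsSolutionFrom {E : Type*} [NormedAddCommGroup E] [NormedSpace ℝ E]
    (f : E → ℝ → E) (t₀ : ℝ) (x₀ : E) (s : ℝ → E) : Prop :=
  s t₀ = x₀ ∧ ∀ t ∈ Ici t₀, HasDerivWithinAt s (f (s t) t) (Ici t₀) t

/-- The transition function `s(t; x₀, t₀)` exists and is unique: for every initial time `t₀ ≥ 0`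
and every initial state there is exactly one solution on `[t₀, ∞)`. -/
def HasTransitionFunction {E : Type*} [NormedAddCommGroup E] [NormedSpace ℝ E]
    (f : E → ℝ → E) : Prop :=
  ∀ t₀ : ℝ, 0 ≤ t₀ → ∀ x₀ : E, ∃ s : ℝ → E, IsSolutionFrom f t₀ x₀ s ∧
    ∀ s' : ℝ → E, IsSolutionFrom f t₀ x₀ s' → EqOn s' s (Ici t₀)

/-- `0` is an equilibrium of `x' = f(x, t)`. -/
def IsEquilibriumZero {E : Type*} [NormedAddCommGroup E] (f : E → ℝ → E) : Prop :=
  ∀ t : ℝ, 0 ≤ t → f 0 t = 0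

def UniformlyStable {E : Type*} [NormedAddCommGroup E] [NormedSpace ℝ E]
    (f : E → ℝ → E) : Prop :=
  ∀ ε : ℝ, 0 < ε → ∃ δ : ℝ, 0 < δ ∧ ∀ t₀ : ℝ, 0 ≤ t₀ → ∀ (x₀ : E) (s : ℝ → E),
    IsSolutionFrom f t₀ x₀ s → ‖x₀‖ ≤ δ → ∀ t : ℝ, t₀ ≤ t → ‖s t‖ ≤ ε

def UniformlyBounded {E : Type*} [NormedAddCommGroup E] [NormedSpace ℝ E]
    (f : E → ℝ → E) : Prop :=
  ∀ ρ : ℝ, 0 < ρ → ∃ b : ℝ, ∀ t₀ : ℝ, 0 ≤ t₀ → ∀ (x₀ : E) (s : ℝ → E),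
    IsSolutionFrom f t₀ x₀ s → ‖x₀‖ ≤ ρ → ∀ t : ℝ, t₀ ≤ t → ‖s t‖ ≤ b

def UniformlyAttractingInTheLarge {E : Type*} [NormedAddCommGroup E] [NormedSpace ℝ E]
    (f : E → ℝ → E) : Prop :=
  ∀ ρ : ℝ, 0 < ρ → ∀ η : ℝ, 0 < η → ∃ T : ℝ, 0 ≤ T ∧ ∀ t₀ : ℝ, 0 ≤ t₀ →
    ∀ (x₀ : E) (s : ℝ → E), IsSolutionFrom f t₀ x₀ s → ‖x₀‖ ≤ ρ →
      ∀ t : ℝ, t₀ + T ≤ t → ‖s t‖ ≤ η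

/-- The equilibrium `0` is uniformly asymptotically stable in the large. -/
def IsUASL {E : Type*} [NormedAddCommGroup E] [NormedSpace ℝ E] (f : E → ℝ → E) : Prop :=
  UniformlyStable f ∧ UniformlyBounded f ∧ UniformlyAttractingInTheLarge f

/-! ### Signals on `[0, ∞)` -/

/-- Piecewise continuity on `[0, ∞)`: finitely many discontinuities in every bounded interval,
and finite one-sided limits everywhere. -/
def PiecewiseContinuous (r : ℝ → ℝ) : Prop :=
  (∀ b : ℝ, {t : ℝ | t ∈ Icc 0 b ∧ ¬ ContinuousWithinAt r (Ici 0) t}.Finite) ∧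
  (∀ t : ℝ, 0 ≤ t → ∃ l : ℝ, Tendsto r (𝓝[>] t) (𝓝 l)) ∧
  (∀ t : ℝ, 0 < t → ∃ l : ℝ, Tendsto r (𝓝[<] t) (𝓝 l))

/-- Boundedness on `[0, ∞)`. -/
def BoundedSignal {E : Type*} [NormedAddCommGroup E] (y : ℝ → E) : Prop :=
  ∃ β : ℝ, ∀ t : ℝ, 0 ≤ t → ‖y t‖ ≤ β

/-- The matrix `∫ₜ^{t+T} y(τ) y(τ)ᵀ dτ`. -/
noncomputable def excitationMatrix {n : ℕ} (y : ℝ → EuclideanSpace ℝ (Fin n)) (t T : ℝ) :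
    Matrix (Fin n) (Fin n) ℝ :=
  Matrix.of fun i j => ∫ τ in t..(t + T), y τ i * y τ j

/-- Persistent excitation on `[0, ∞)`: `∫ₜ^{t+T} y yᵀ dτ ⪰ α I` for all `t ≥ 0`. -/
def PersistentlyExciting {n : ℕ} (y : ℝ → EuclideanSpace ℝ (Fin n)) : Prop :=
  ∃ T : ℝ, 0 < T ∧ ∃ α : ℝ, 0 < α ∧ ∀ t : ℝ, 0 ≤ t →
    (excitationMatrix y t T - α • (1 : Matrix (Fin n) (Fin n) ℝ)).PosSemidef

/-! ### Model reference adaptive control -/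

/-- All complex eigenvalues have negative real part. -/
def IsHurwitz {n : ℕ} (A : Matrix (Fin n) (Fin n) ℝ) : Prop :=
  ∀ μ ∈ spectrum ℂ (A.map Complex.ofReal), μ.re < 0

/-- `x_m` solves `x_m' = A x_m + B r` on `[0, ∞)` for a piecewise continuous `r`: it is continuous
and satisfies the equation at every time at which `r` is continuous. -/
def IsReferenceState {n : ℕ} (A : Matrix (Fin n) (Fin n) ℝ) (B : Fin n → ℝ)
    (r : ℝ → ℝ) (xm : ℝ → EuclideanSpace ℝ (Fin n)) : Prop :=
  ContinuousOn xm (Ici 0) ∧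
  ∀ t : ℝ, 0 ≤ t → ContinuousWithinAt r (Ici 0) t →
    HasDerivWithinAt xm (WithLp.toLp 2 (A.mulVec (xm t) + r t • B)) (Ici 0) t

/-- The plant state `x = x_m + e` as a function of time and of `z = (e, φ)`. -/
def plantState {n : ℕ} (xm : ℝ → EuclideanSpace ℝ (Fin n))
    (z : EuclideanSpace ℝ (Fin n ⊕ Fin n)) (t : ℝ) : Fin n → ℝ :=
  fun i => xm t i + z (Sum.inl i)

/-- The right-hand side `[[A, B xᵀ], [-x Cᵀ, 0]] z` of the error dynamics, where `z = (e, φ)`,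
`x = x_m(t) + e` and `C = P B`. -/
noncomputable def errorField {n : ℕ} (A P : Matrix (Fin n) (Fin n) ℝ) (B : Fin n → ℝ)
    (xm : ℝ → EuclideanSpace ℝ (Fin n)) (z : EuclideanSpace ℝ (Fin n ⊕ Fin n)) (t : ℝ) :
    EuclideanSpace ℝ (Fin n ⊕ Fin n) :=
  WithLp.toLp 2 ((Matrix.fromBlocks A (Matrix.vecMulVec B (plantState xm z t))
    (-(Matrix.vecMulVec (plantState xm z t) (P.mulVec B))) 0).mulVec z)

/-! ### Differential inequalities -/

/-- A function whose right derivative is at most `-c` decreases at least at rate `c`. -/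
theorem le_sub_mul_of_deriv_right_le {u u' : ℝ → ℝ} {a b c : ℝ} (hab : a ≤ b)
    (hu : ContinuousOn u (Icc a b))
    (hu' : ∀ t ∈ Ico a b, HasDerivWithinAt u (u' t) (Ici t) t)
    (hc : ∀ t ∈ Ico a b, u' t ≤ -c) : u b ≤ u a - c * (b - a) := by
  have hB : ∀ t, HasDerivAt (fun t => u a - c * (t - a)) (-c) t := fun t => by
    simpa using (((hasDerivAt_id t).sub_const a).const_mul c).const_sub (u a)
  exact image_le_of_deriv_right_le_deriv_boundary hu hu' (B := fun t => u a - c * (t - a))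
    (by simp) (fun t _ => (hB t).continuousAt.continuousWithinAt)
    (fun t _ => (hB t).hasDerivWithinAt) hc (right_mem_Icc.2 hab)

/-- If a nonincreasing nonnegative quantity drops by at least `c` over every window of length `L`
on which it starts at `η` or above, then it is below `η` after `N` windows, where `N c` exceeds its
initial value. -/
theorem lt_of_decrement {u : ℝ → ℝ} {t₀ L c η : ℝ} {N : ℕ} (hL : 0 < L)
    (hu : AntitoneOn u (Ici t₀)) (hpos : ∀ t ∈ Ici t₀, 0 ≤ u t)
    (hdec : ∀ t ∈ Ici t₀, η ≤ u t → u (t + L) ≤ u t - c) (hN : u t₀ < N * c)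
    {t : ℝ} (ht : t₀ + N * L ≤ t) : u t < η := by
  by_contra! h
  have hmem : ∀ k : ℕ, t₀ + k * L ∈ Ici t₀ := fun k => by
    have : 0 ≤ k * L := by positivity
    simpa using this
  have key : ∀ k : ℕ, k ≤ N → u (t₀ + k * L) ≤ u t₀ - k * c := by
    intro k
    induction k with
    | zero => simp
    | succ k ih =>
      intro hk
      have hkN : (k : ℝ) * L ≤ N * L := by
        have : (k : ℝ) ≤ N := by exact_mod_cast (Nat.le_of_succ_le hk)
        gcongr
      have h1 : η ≤ u (t₀ + k * L) :=
        h.trans (hu (hmem k) (mem_Ici.2 ((hmem N).trans ht)) (by linarith))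
      have h2 := hdec _ (hmem k) h1
      have h3 := ih (Nat.le_of_succ_le hk)
      have h4 : t₀ + ((k + 1 : ℕ) : ℝ) * L = t₀ + k * L + L := by push_cast; ring
      rw [h4]
      push_cast
      linarith
  have := key N le_rfl
  have := hpos _ (hmem N)
  linarith

section Cutoff

variable {E : Type*} [NormedAddCommGroup E]

/-- The cutoff function equal to `1` on the ball of radius `R` and to `0` outside the ball of
radius `R + 1`. -/
noncomputable def ballCutoff (R : ℝ) (z : E) : ℝ := max 0 (min 1 (R + 1 - ‖z‖))

theorem ballCutoff_nonneg (R : ℝ) (z : E) : 0 ≤ ballCutoff R z := le_max_left _ _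

theorem ballCutoff_le_one (R : ℝ) (z : E) : ballCutoff R z ≤ 1 :=
  max_le zero_le_one (min_le_left _ _)

theorem ballCutoff_eq_one {R : ℝ} {z : E} (h : ‖z‖ ≤ R) : ballCutoff R z = 1 := by
  rw [ballCutoff, min_eq_left (by linarith), max_eq_right zero_le_one]

theorem ballCutoff_eq_zero {R : ℝ} {z : E} (h : R + 1 ≤ ‖z‖) : ballCutoff R z = 0 := by
  rw [ballCutoff, max_eq_left]
  exact (min_le_right _ _).trans (by linarith)

theorem abs_ballCutoff_sub_le (R : ℝ) (z w : E) :
    |ballCutoff R z - ballCutoff R w| ≤ ‖z - w‖ := by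
  have h : LipschitzWith 1 (fun x : ℝ => max 0 (min 1 (R + 1 - x))) := by
    have : LipschitzWith 1 (fun x : ℝ => R + 1 - x) := by
      refine LipschitzWith.of_dist_le_mul fun x y => ?_
      rw [Real.dist_eq, Real.dist_eq, show R + 1 - x - (R + 1 - y) = y - x by ring, abs_sub_comm]
      simp
    exact (this.const_min 1).const_max 0
  have := h.dist_le_mul ‖z‖ ‖w‖
  rw [Real.dist_eq, Real.dist_eq] at this
  refine this.trans ?_
  simpa using abs_norm_sub_norm_le z w

end Cutoff

section ODE

variable {E : Type*} [NormedAddCommGroup E] [NormedSpace ℝ E]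

theorem IsSolutionFrom.continuousOn {f : E → ℝ → E} {t₀ : ℝ} {x₀ : E} {s : ℝ → E}
    (hs : IsSolutionFrom f t₀ x₀ s) : ContinuousOn s (Ici t₀) :=
  fun t ht => (hs.2 t ht).continuousWithinAt

theorem IsSolutionFrom.hasDerivWithinAt_Ici {f : E → ℝ → E} {t₀ : ℝ} {x₀ : E} {s : ℝ → E}
    (hs : IsSolutionFrom f t₀ x₀ s) {t : ℝ} (ht : t₀ ≤ t) :
    HasDerivWithinAt s (f (s t) t) (Ici t) t :=
  (hs.2 t ht).mono (Ici_subset_Ici.2 ht)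

/-- A function with nonpositive derivative along the field does not increase along a curve. -/
theorem comp_le_of_fderiv_nonpos {V : E → ℝ} {V' : E → E →L[ℝ] ℝ}
    (hV : ∀ z, HasFDerivAt V (V' z) z) {s s' : ℝ → E} {a b : ℝ} (hab : a ≤ b)
    (hs : ContinuousOn s (Icc a b)) (hs' : ∀ t ∈ Ico a b, HasDerivWithinAt s (s' t) (Ici t) t)
    (hle : ∀ t ∈ Ico a b, V' (s t) (s' t) ≤ 0) : V (s b) ≤ V (s a) := by
  have hc : Continuous V := continuous_iff_continuousAt.2 fun z => (hV z).continuousAt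
  have := le_sub_mul_of_deriv_right_le (u := fun t => V (s t)) (c := 0) hab
    (hc.comp_continuousOn hs)
    (fun t ht => (hV (s t)).comp_hasDerivWithinAt t (hs' t ht)) (by simpa using hle)
  simpa using this

/-- The field is Lipschitz on bounded sets, uniformly in `t ≥ 0`. -/
def LipschitzOnBounded (f : E → ℝ → E) : Prop :=
  ∀ R : ℝ, ∃ K : NNReal, ∀ t : ℝ, 0 ≤ t → LipschitzOnWith K (fun z => f z t) (Metric.closedBall 0 R)

/-- Two solutions of a locally Lipschitz equation with the same initial value agree. -/
theorem LipschitzOnBounded.eqOn {f : E → ℝ → E} (hf : LipschitzOnBounded f) {a b : ℝ} (ha : 0 ≤ a)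
    {s s' : ℝ → E} (hs : ContinuousOn s (Icc a b))
    (hsd : ∀ t ∈ Ico a b, HasDerivWithinAt s (f (s t) t) (Ici t) t)
    (hs' : ContinuousOn s' (Icc a b))
    (hsd' : ∀ t ∈ Ico a b, HasDerivWithinAt s' (f (s' t) t) (Ici t) t)
    (h0 : s a = s' a) : EqOn s s' (Icc a b) := by
  obtain ⟨C, hC⟩ := isCompact_Icc.exists_bound_of_continuousOn hs
  obtain ⟨C', hC'⟩ := isCompact_Icc.exists_bound_of_continuousOn hs'
  obtain ⟨K, hK⟩ := hf (max C C')
  refine ODE_solution_unique_of_mem_Icc_right (v := fun t z => f z t) (K := K)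
    (s := fun _ => Metric.closedBall 0 (max C C'))
    (fun t ht => hK t (ha.trans ht.1)) hs hsd (fun t ht => ?_) hs' hsd' (fun t ht => ?_) h0
  · simpa using Or.inl (hC t (Ico_subset_Icc_self ht))
  · simpa using Or.inr (hC' t (Ico_subset_Icc_self ht))

variable [CompleteSpace E]

/-- Global existence on a compact interval, from a function that does not increase along the field
and has bounded sublevel sets. -/
theorem LipschitzOnBounded.exists_solution_Icc {f : E → ℝ → E} (hf : LipschitzOnBounded f)
    (hf0 : ∀ t : ℝ, 0 ≤ t → f 0 t = 0) (hcont : ∀ z, ContinuousOn (f z) (Ici 0))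
    {V : E → ℝ} {V' : E → E →L[ℝ] ℝ} (hV : ∀ z, HasFDerivAt V (V' z) z)
    (hle : ∀ t, 0 ≤ t → ∀ z, V' z (f z t) ≤ 0)
    (hbdd : ∀ c, ∃ R, ∀ z, V z ≤ c → ‖z‖ ≤ R)
    {t₀ t₁ : ℝ} (ht₀ : 0 ≤ t₀) (ht : t₀ ≤ t₁) (x₀ : E) :
    ∃ s : ℝ → E, s t₀ = x₀ ∧ ∀ t ∈ Icc t₀ t₁, HasDerivWithinAt s (f (s t) t) (Icc t₀ t₁) t := by
  obtain ⟨R', hR'⟩ := hbdd (V x₀)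
  set R := max R' 0
  have hR : ∀ z, V z ≤ V x₀ → ‖z‖ ≤ R := fun z hz => (hR' z hz).trans (le_max_left _ _)
  have hR0 : 0 ≤ R := le_max_right _ _
  have hnorm : ∀ {ρ : ℝ} {K : NNReal}, 0 ≤ ρ →
      (∀ t : ℝ, 0 ≤ t → LipschitzOnWith K (fun z => f z t) (Metric.closedBall 0 ρ)) →
      ∀ t, 0 ≤ t → ∀ z, ‖z‖ ≤ ρ → ‖f z t‖ ≤ K * ρ := by
    intro ρ K hρ hK t ht z hz
    have := (hK t ht).norm_sub_le (x := z) (y := 0) (by simpa using hz) (by simpa using hρ)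
    rw [hf0 t ht, sub_zero, sub_zero] at this
    exact this.trans (by gcongr)
  obtain ⟨K₁, hK₁⟩ := hf (R + 1)
  set L : NNReal := K₁ * (R + 1).toNNReal
  have hL : (L : ℝ) = K₁ * (R + 1) := by simp [L, Real.coe_toNNReal _ (by linarith : 0 ≤ R + 1)]
  set a : NNReal := L * (t₁ - t₀).toNNReal
  obtain ⟨K₂, hK₂⟩ := hf (‖x₀‖ + a)
  set M : NNReal := K₂ * (‖x₀‖₊ + a)
  set g : ℝ → E → E := fun t z => ballCutoff R z • f z t with hg
  have hball : ∀ z ∈ Metric.closedBall x₀ (a : ℝ), z ∈ Metric.closedBall (0 : E) (‖x₀‖ + a) := by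
    intro z hz
    rw [mem_closedBall_iff_norm] at hz
    rw [mem_closedBall_zero_iff]
    calc ‖z‖ = ‖x₀ + (z - x₀)‖ := by congr 1; abel
      _ ≤ _ := (norm_add_le _ _).trans (by gcongr)
  have hPL : IsPicardLindelof g (⟨t₀, left_mem_Icc.2 ht⟩ : Icc t₀ t₁) x₀ a 0 L (K₂ + M) := by
    refine ⟨fun t htt => ?_, fun z _ => ?_, fun t htt z _ => ?_, ?_⟩
    · have h0 : 0 ≤ t := ht₀.trans htt.1
      refine LipschitzOnWith.of_dist_le_mul fun z hz w hw => ?_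
      rw [dist_eq_norm, dist_eq_norm]
      have e : g t z - g t w = ballCutoff R z • (f z t - f w t) +
          (ballCutoff R z - ballCutoff R w) • f w t := by
        simp only [hg, smul_sub, sub_smul]; abel
      rw [e]
      have h1 := (hK₂ t h0).norm_sub_le (hball z hz) (hball w hw)
      have h2 := hnorm (by positivity) hK₂ t h0 w (by simpa using hball w hw)
      have h3 := abs_ballCutoff_sub_le R z w
      calc _ ≤ ‖ballCutoff R z • (f z t - f w t)‖ + ‖(ballCutoff R z - ballCutoff R w) • f w t‖ :=
            norm_add_le _ _
        _ ≤ 1 * (K₂ * ‖z - w‖) + ‖z - w‖ * (K₂ * (‖x₀‖ + a)) := by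
            rw [norm_smul, norm_smul, Real.norm_of_nonneg (ballCutoff_nonneg R z), Real.norm_eq_abs]
            gcongr
            exact ballCutoff_le_one R z
        _ = _ := by simp [M]; ring
    · exact ((hcont z).mono fun t htt => ht₀.trans htt.1).const_smul _
    · have h0 : 0 ≤ t := ht₀.trans htt.1
      rw [hL, hg]
      rcases le_total (R + 1) ‖z‖ with h | h
      · simp only [ballCutoff_eq_zero h, zero_smul, norm_zero]; positivity
      · rw [norm_smul, Real.norm_of_nonneg (ballCutoff_nonneg R z)]
        exact (mul_le_of_le_one_left (norm_nonneg _) (ballCutoff_le_one R z)).trans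
          (hnorm (by positivity) hK₁ t h0 z h)
    · simp [a, Real.coe_toNNReal _ (sub_nonneg.2 ht), ht]
  obtain ⟨s, hs0, hs⟩ := hPL.exists_eq_forall_mem_Icc_hasDerivWithinAt₀
  refine ⟨s, hs0, fun t htt => ?_⟩
  have hVt : V (s t) ≤ V x₀ := by
    rw [← hs0]
    refine comp_le_of_fderiv_nonpos hV htt.1
      (fun τ hτ => ((hs τ ⟨hτ.1, hτ.2.trans htt.2⟩).continuousWithinAt).mono
        (Icc_subset_Icc_right htt.2))
      (fun τ hτ => (hs τ ⟨hτ.1, hτ.2.le.trans htt.2⟩).mono_of_mem_nhdsWithin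
        (Icc_mem_nhdsGE_of_mem ⟨hτ.1, hτ.2.trans_le htt.2⟩)) (fun τ hτ => ?_)
    simp only [hg, map_smul, smul_eq_mul]
    exact mul_nonpos_of_nonneg_of_nonpos (ballCutoff_nonneg _ _) (hle τ (ht₀.trans hτ.1) _)
  have := hs t htt
  rwa [show g t (s t) = f (s t) t by
    simp only [hg, ballCutoff_eq_one (hR _ hVt), one_smul]] at this

/-- Global existence and uniqueness, from a function that does not increase along the field and has
bounded sublevel sets. -/
theorem LipschitzOnBounded.hasTransitionFunction {f : E → ℝ → E} (hf : LipschitzOnBounded f)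
    (hf0 : ∀ t : ℝ, 0 ≤ t → f 0 t = 0) (hcont : ∀ z, ContinuousOn (f z) (Ici 0))
    {V : E → ℝ} {V' : E → E →L[ℝ] ℝ} (hV : ∀ z, HasFDerivAt V (V' z) z)
    (hle : ∀ t, 0 ≤ t → ∀ z, V' z (f z t) ≤ 0)
    (hbdd : ∀ c, ∃ R, ∀ z, V z ≤ c → ‖z‖ ≤ R) : HasTransitionFunction f := by
  intro t₀ ht₀ x₀
  have hex : ∀ N : ℕ, ∃ s : ℝ → E, s t₀ = x₀ ∧
      ∀ t ∈ Icc t₀ (t₀ + N), HasDerivWithinAt s (f (s t) t) (Icc t₀ (t₀ + N)) t := fun N =>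
    hf.exists_solution_Icc hf0 hcont hV hle hbdd ht₀ (by simp) x₀
  choose σ hσ0 hσ using hex
  have hder : ∀ (N : ℕ), ∀ t ∈ Ico t₀ (t₀ + N),
      HasDerivWithinAt (σ N) (f (σ N t) t) (Ici t) t := fun N t ht =>
    (hσ N t (Ico_subset_Icc_self ht)).mono_of_mem_nhdsWithin (Icc_mem_nhdsGE_of_mem ht)
  have hc : ∀ N : ℕ, ContinuousOn (σ N) (Icc t₀ (t₀ + N)) := fun N t ht =>
    (hσ N t ht).continuousWithinAt
  have hagree : ∀ M N : ℕ, M ≤ N → EqOn (σ M) (σ N) (Icc t₀ (t₀ + M)) := by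
    intro M N hMN
    have h : t₀ + (M : ℝ) ≤ t₀ + N := by
      have : (M : ℝ) ≤ N := by exact_mod_cast hMN
      linarith
    exact hf.eqOn ht₀ (hc M) (hder M) ((hc N).mono (Icc_subset_Icc_right h))
      (fun t ht => hder N t ⟨ht.1, ht.2.trans_le h⟩) ((hσ0 M).trans (hσ0 N).symm)
  set s : ℝ → E := fun t => σ ⌈t - t₀⌉₊ t with hs
  have hsN : ∀ N : ℕ, EqOn s (σ N) (Icc t₀ (t₀ + N)) := by
    intro N t ht
    refine hagree _ N (Nat.ceil_le.2 (by linarith [ht.2])) ⟨ht.1, ?_⟩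
    linarith [Nat.le_ceil (t - t₀)]
  have hsol : IsSolutionFrom f t₀ x₀ s := by
    refine ⟨by simp [hs, hσ0], fun t ht => ?_⟩
    obtain ⟨N, hN⟩ := exists_nat_gt (t - t₀)
    have htN : t < t₀ + N := by linarith
    have hmem : t ∈ Icc t₀ (t₀ + N) := ⟨ht, htN.le⟩
    have h1 := (hσ N t hmem).congr (hsN N) (hsN N hmem)
    rw [← hsN N hmem] at h1
    refine h1.mono_of_mem_nhdsWithin ?_
    rw [← Ici_inter_Iic]
    exact inter_mem_nhdsWithin _ (Iic_mem_nhds htN)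
  refine ⟨s, hsol, fun s' hs' t ht => ?_⟩
  exact hf.eqOn ht₀ (hs'.continuousOn.mono Icc_subset_Ici_self)
    (fun τ hτ => hs'.hasDerivWithinAt_Ici hτ.1) (hsol.continuousOn.mono Icc_subset_Ici_self)
    (fun τ hτ => hsol.hasDerivWithinAt_Ici hτ.1) (hs'.1.trans hsol.1.symm) (right_mem_Icc.2 ht)

end ODE

/-! ### Stability from a quadratically bounded Lyapunov function -/

/-- If `u' ≤ -q ‖y‖²` and `y` is Lipschitz, then `u` drops by a definite amount after a time at
which `‖y‖ ≥ ε`. -/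
theorem le_sub_of_deriv_le_neg_mul_sq {E : Type*} [NormedAddCommGroup E]
    {u u' : ℝ → ℝ} {y : ℝ → E} {s q K ε h : ℝ} (hq : 0 ≤ q)
    (hK : 0 ≤ K) (hh : 0 ≤ h) (hε : 0 ≤ ε) (hKh : K * h ≤ ε / 2)
    (hu : ContinuousOn u (Icc s (s + h)))
    (hu' : ∀ t ∈ Ico s (s + h), HasDerivWithinAt u (u' t) (Ici t) t)
    (hle : ∀ t ∈ Ico s (s + h), u' t ≤ -(q * ‖y t‖ ^ 2))
    (hy : ∀ t ∈ Ico s (s + h), ‖y t - y s‖ ≤ K * (t - s)) (hs : ε ≤ ‖y s‖) :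
    u (s + h) ≤ u s - q * (ε / 2) ^ 2 * h := by
  have := le_sub_mul_of_deriv_right_le (c := q * (ε / 2) ^ 2) (by linarith) hu hu' fun t ht => by
    have h1 : ε / 2 ≤ ‖y t‖ := by
      have h2 := hy t ht
      have h3 : K * (t - s) ≤ K * h := by
        gcongr
        linarith [ht.2]
      have h4 := norm_sub_norm_le (y s) (y t)
      rw [norm_sub_rev] at h4
      linarith
    refine (hle t ht).trans (neg_le_neg ?_)
    gcongr
  simpa using this

section Lyapunov

variable {E : Type*} [NormedAddCommGroup E] [NormedSpace ℝ E]

theorem IsSolutionFrom.antitoneOn {f : E → ℝ → E} {t₀ : ℝ} {x₀ : E} {s : ℝ → E}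
    (hs : IsSolutionFrom f t₀ x₀ s) (ht₀ : 0 ≤ t₀)
    {V : E → ℝ} {V' : E → E →L[ℝ] ℝ} (hV : ∀ z, HasFDerivAt V (V' z) z)
    (hle : ∀ t, 0 ≤ t → ∀ z, V' z (f z t) ≤ 0) : AntitoneOn (fun t => V (s t)) (Ici t₀) :=
  fun _ ha _ _ hab => comp_le_of_fderiv_nonpos hV hab
    (hs.continuousOn.mono fun _ hτ => le_trans ha hτ.1)
    (fun _ hτ => hs.hasDerivWithinAt_Ici (le_trans ha hτ.1))
    (fun _ hτ => hle _ (ht₀.trans (le_trans ha hτ.1)) _)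

theorem IsSolutionFrom.norm_le {f : E → ℝ → E} {t₀ : ℝ} {x₀ : E} {s : ℝ → E}
    (hs : IsSolutionFrom f t₀ x₀ s) (ht₀ : 0 ≤ t₀)
    {V : E → ℝ} {V' : E → E →L[ℝ] ℝ} (hV : ∀ z, HasFDerivAt V (V' z) z)
    (hle : ∀ t, 0 ≤ t → ∀ z, V' z (f z t) ≤ 0) {l m : ℝ} (hl : 0 < l)
    (hlV : ∀ z, l * ‖z‖ ^ 2 ≤ V z) (hVm : ∀ z, V z ≤ m * ‖z‖ ^ 2) {t : ℝ} (ht : t₀ ≤ t) :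
    ‖s t‖ ≤ √(m / l) * ‖x₀‖ := by
  have h1 : V (s t) ≤ V (s t₀) := hs.antitoneOn ht₀ hV hle self_mem_Ici ht ht
  rw [hs.1] at h1
  have h2 := hlV (s t)
  have h3 := hVm x₀
  have h4 : ‖s t‖ ^ 2 ≤ m / l * ‖x₀‖ ^ 2 := by
    rw [div_mul_eq_mul_div, le_div_iff₀ hl]
    linarith
  calc ‖s t‖ = √(‖s t‖ ^ 2) := (Real.sqrt_sq (norm_nonneg _)).symm
    _ ≤ √(m / l * ‖x₀‖ ^ 2) := Real.sqrt_le_sqrt h4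
    _ = _ := by rw [Real.sqrt_mul' _ (sq_nonneg _), Real.sqrt_sq (norm_nonneg _)]

theorem uniformlyStable_of_norm_le {f : E → ℝ → E} {C : ℝ} (hC : 0 ≤ C)
    (h : ∀ t₀ : ℝ, 0 ≤ t₀ → ∀ x₀ s, IsSolutionFrom f t₀ x₀ s → ∀ t, t₀ ≤ t → ‖s t‖ ≤ C * ‖x₀‖) :
    UniformlyStable f := by
  intro ε hε
  refine ⟨ε / (C + 1), by positivity, fun t₀ ht₀ x₀ s hs hx t ht => ?_⟩
  calc ‖s t‖ ≤ C * ‖x₀‖ := h t₀ ht₀ x₀ s hs t ht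
    _ ≤ (C + 1) * (ε / (C + 1)) := by gcongr; linarith
    _ = ε := by field_simp

theorem uniformlyBounded_of_norm_le {f : E → ℝ → E} {C : ℝ} (hC : 0 ≤ C)
    (h : ∀ t₀ : ℝ, 0 ≤ t₀ → ∀ x₀ s, IsSolutionFrom f t₀ x₀ s → ∀ t, t₀ ≤ t → ‖s t‖ ≤ C * ‖x₀‖) :
    UniformlyBounded f := fun ρ _ => ⟨C * ρ, fun t₀ ht₀ x₀ s hs hx t ht =>
  (h t₀ ht₀ x₀ s hs t ht).trans (by gcongr)⟩

/-- A curve that stays in the ball of radius `ε` and whose derivative is `K`-Lipschitz has a small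
derivative. -/
theorem norm_deriv_le_of_norm_le {y y' : ℝ → E} {s h K ε : ℝ} (hh : 0 < h) (hK : 0 ≤ K)
    (hy : ∀ t ∈ Icc s (s + h), HasDerivWithinAt y (y' t) (Icc s (s + h)) t)
    (hy' : ∀ t ∈ Icc s (s + h), ‖y' t - y' s‖ ≤ K * (t - s))
    (hε : ∀ t ∈ Icc s (s + h), ‖y t‖ ≤ ε) : ‖y' s‖ ≤ 2 * ε / h + K * h := by
  have hs : s ∈ Icc s (s + h) := ⟨le_rfl, by linarith⟩
  have hsh : s + h ∈ Icc s (s + h) := ⟨by linarith, le_rfl⟩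
  have h1 := norm_image_sub_le_of_norm_deriv_le_segment' (a := s) (b := s + h) (C := K * h)
    (f := fun t => y t - (t - s) • y' s) (f' := fun t => y' t - y' s)
    (fun t ht => by
      simpa using (hy t ht).fun_sub
        ((((hasDerivAt_id t).sub_const s).smul_const (y' s)).hasDerivWithinAt))
    (fun t ht => (hy' t (Ico_subset_Icc_self ht)).trans (by gcongr; linarith [ht.2])) _ hsh
  simp only [add_sub_cancel_left, sub_self, zero_smul, sub_zero] at h1
  have h2 : ‖h • y' s‖ ≤ K * h * h + 2 * ε := by
    calc ‖h • y' s‖ = ‖(y (s + h) - y s) - (y (s + h) - h • y' s - y s)‖ := by congr 1; abel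
      _ ≤ ‖y (s + h) - y s‖ + ‖y (s + h) - h • y' s - y s‖ := norm_sub_le _ _
      _ ≤ (‖y (s + h)‖ + ‖y s‖) + K * h * h := add_le_add (norm_sub_le _ _) h1
      _ ≤ _ := by linarith [hε _ hs, hε _ hsh]
  rw [norm_smul, Real.norm_of_nonneg hh.le] at h2
  have h3 : 2 * ε / h + K * h = (K * h * h + 2 * ε) / h := by field_simp; ring
  rw [h3, le_div_iff₀ hh]
  linarith

end Lyapunov

section Excitation

variable {H : Type*} [NormedAddCommGroup H] [InnerProductSpace ℝ H]

/-- If the error `e` is small on a window on which the regressor `w` is exciting, then so is the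
parameter error `φ` at the start of the window. The constant depends only on bounds of the data. -/
theorem exists_forall_norm_parameter_le (A : H →L[ℝ] H) {b : H} (hb : b ≠ 0) (c : H)
    {T α K R β η : ℝ} (hT : 0 < T) (hα : 0 < α) (hK : 0 ≤ K) (hβ : 0 ≤ β)
    (hη : 0 < η) : ∃ ε₀ > 0, ∀ ε, 0 < ε → ε ≤ ε₀ → ∀ (a : ℝ) (w e φ e' : ℝ → H),
      (∀ t ∈ Icc a (a + T + 1), HasDerivWithinAt e (e' t) (Icc a (a + T + 1)) t) →
      (∀ t ∈ Icc a (a + T + 1), e' t = A (e t) + inner ℝ (w t + e t) (φ t) • b) →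
      (∀ s ∈ Icc a (a + T + 1), ∀ t ∈ Icc a (a + T + 1), ‖e' t - e' s‖ ≤ K * |t - s|) →
      (∀ t ∈ Icc a (a + T + 1),
        HasDerivWithinAt φ (-(inner ℝ c (e t) • (w t + e t))) (Icc a (a + T + 1)) t) →
      (∀ t ∈ Icc a (a + T + 1), ‖w t‖ ≤ β) → (∀ t ∈ Icc a (a + T + 1), ‖φ t‖ ≤ R) →
      (∀ t ∈ Icc a (a + T + 1), ‖e t‖ ≤ ε) →
      (∀ v, α * ‖v‖ ^ 2 ≤ ∫ τ in a..(a + T), inner ℝ (w τ) v ^ 2) → ‖φ a‖ ≤ η := by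
  have hb' : 0 < ‖b‖ := norm_pos_iff.2 hb
  set δ : ℝ := η * √(α / T) with hδdef
  have hδ : 0 < δ := by positivity
  obtain ⟨h, hh0, hh1, hhK⟩ : ∃ h : ℝ, 0 < h ∧ h ≤ 1 ∧ K * h / ‖b‖ < δ := by
    have : Tendsto (fun h : ℝ => K * h / ‖b‖) (𝓝[>] 0) (𝓝 (K * 0 / ‖b‖)) :=
      (Continuous.tendsto (by fun_prop) 0).mono_left nhdsWithin_le_nhds
    have h1 := this.eventually (gt_mem_nhds (show K * 0 / ‖b‖ < δ by simpa using hδ))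
    have h2 : ∀ᶠ h : ℝ in 𝓝[>] 0, h ≤ 1 :=
      nhdsWithin_le_nhds (eventually_le_nhds (show (0 : ℝ) < 1 by norm_num))
    obtain ⟨h, ⟨h1, h2⟩, h3⟩ := ((h1.and h2).and self_mem_nhdsWithin).exists
    exact ⟨h, h3, h2, h1⟩
  set g : ℝ → ℝ := fun ε => (2 * ε / h + K * h + ‖A‖ * ε) / ‖b‖ + ε * R +
    β * (‖c‖ * ε * (β + ε) * T) with hg
  obtain ⟨ε₀, hε₀, hgε⟩ : ∃ ε₀ > 0, ∀ ε, 0 < ε → ε ≤ ε₀ → g ε ≤ δ := by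
    have : Tendsto g (𝓝[>] 0) (𝓝 (g 0)) :=
      (Continuous.tendsto (by fun_prop) 0).mono_left nhdsWithin_le_nhds
    have h1 := this.eventually (gt_mem_nhds (show g 0 < δ by simpa [hg] using hhK))
    obtain ⟨ε₀, h0, h2⟩ := mem_nhdsGT_iff_exists_Ioc_subset.1 h1
    exact ⟨ε₀, h0, fun ε h3 h4 => (h2 ⟨h3, h4⟩ : g ε < δ).le⟩
  refine ⟨ε₀, hε₀, fun ε hε hεε a w e φ e' he he' hLip hφ hw hφR heε hPE => ?_⟩
  have hsmall : ∀ s ∈ Icc a (a + T), |inner ℝ (w s) (φ a)| ≤ δ := by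
    intro s hs
    have hs' : s ∈ Icc a (a + T + 1) := ⟨hs.1, by linarith [hs.2]⟩
    have ha : a ∈ Icc a (a + T + 1) := ⟨le_rfl, by linarith⟩
    have hsub : Icc s (s + h) ⊆ Icc a (a + T + 1) := Icc_subset_Icc hs.1 (by linarith [hs.2])
    have h1 : ‖e' s‖ ≤ 2 * ε / h + K * h := norm_deriv_le_of_norm_le hh0 hK
      (fun t ht => (he t (hsub ht)).mono hsub)
      (fun t ht => by
        have := hLip s hs' t (hsub ht)
        rwa [abs_of_nonneg (by linarith [ht.1])] at this)
      (fun t ht => heε t (hsub ht))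
    have h2 : |inner ℝ (w s + e s) (φ s)| ≤ (2 * ε / h + K * h + ‖A‖ * ε) / ‖b‖ := by
      rw [le_div_iff₀ hb', ← Real.norm_eq_abs, ← norm_smul]
      have : inner ℝ (w s + e s) (φ s) • b = e' s - A (e s) := by rw [he' s hs']; abel
      rw [this]
      refine (norm_sub_le _ _).trans (add_le_add h1 ((A.le_opNorm _).trans ?_))
      gcongr
      exact heε s hs'
    have h3 : |inner ℝ (e s) (φ s)| ≤ ε * R := (abs_real_inner_le_norm _ _).trans
      (mul_le_mul (heε s hs') (hφR s hs') (norm_nonneg _) hε.le)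
    have h4 : ‖φ s - φ a‖ ≤ ‖c‖ * ε * (β + ε) * T := by
      have := norm_image_sub_le_of_norm_deriv_le_segment' hφ (C := ‖c‖ * ε * (β + ε))
        (fun t ht => by
          have ht' := Ico_subset_Icc_self ht
          rw [norm_neg, norm_smul]
          gcongr
          · exact (abs_real_inner_le_norm _ _).trans (by gcongr; exact heε t ht')
          · exact (norm_add_le _ _).trans (add_le_add (hw t ht') (heε t ht'))) s hs'
      refine this.trans ?_
      gcongr
      linarith [hs.2]
    have h5 : |inner ℝ (w s) (φ s - φ a)| ≤ β * (‖c‖ * ε * (β + ε) * T) :=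
      (abs_real_inner_le_norm _ _).trans (mul_le_mul (hw s hs') h4 (norm_nonneg _) hβ)
    have h6 : inner ℝ (w s) (φ a) = inner ℝ (w s + e s) (φ s) - inner ℝ (e s) (φ s) -
        inner ℝ (w s) (φ s - φ a) := by
      rw [inner_add_left, inner_sub_right]; ring
    rw [h6]
    refine (abs_sub _ _).trans ((add_le_add_left (abs_sub _ _) _).trans ?_)
    have := hgε ε hε hεε
    simp only [hg] at this
    linarith
  have hint : ∫ τ in a..(a + T), inner ℝ (w τ) (φ a) ^ 2 ≤ δ ^ 2 * T := by
    have := intervalIntegral.norm_integral_le_of_norm_le_const (a := a) (b := a + T)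
      (f := fun τ => inner ℝ (w τ) (φ a) ^ 2) (C := δ ^ 2) fun τ hτ => by
        rw [uIoc_of_le (by linarith)] at hτ
        rw [Real.norm_of_nonneg (sq_nonneg _), ← sq_abs]
        have := hsmall τ (Ioc_subset_Icc_self hτ)
        gcongr
    rw [add_sub_cancel_left, abs_of_pos hT] at this
    exact (le_abs_self _).trans this
  have h7 := (hPE (φ a)).trans hint
  have h8 : δ ^ 2 * T = α * η ^ 2 := by
    rw [hδdef, mul_pow, Real.sq_sqrt (by positivity)]
    field_simp
  rw [h8] at h7
  exact (sq_le_sq₀ (norm_nonneg _) hη.le).1 (le_of_mul_le_mul_left h7 hα)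

end Excitation

/-! ### Quadratic forms, the reference model and persistent excitation -/

section Quadratic

/-- A positive definite quadratic form on a finite-dimensional space is coercive. -/
theorem exists_mul_norm_sq_le_inner {H : Type*} [NormedAddCommGroup H] [InnerProductSpace ℝ H]
    [FiniteDimensional ℝ H] (M : H →L[ℝ] H) (hM : ∀ v, v ≠ 0 → 0 < inner ℝ v (M v)) :
    ∃ q > 0, ∀ v, q * ‖v‖ ^ 2 ≤ inner ℝ v (M v) := by
  rcases (Metric.sphere (0 : H) 1).eq_empty_or_nonempty with h | h
  · refine ⟨1, one_pos, fun v => ?_⟩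
    have hv : v = 0 := by
      by_contra hv
      have : ‖v‖⁻¹ • v ∈ Metric.sphere (0 : H) 1 := by
        simp [norm_smul, inv_mul_cancel₀ (norm_ne_zero_iff.2 hv)]
      simp [h] at this
    simp [hv]
  · obtain ⟨u, hu, hmin⟩ := (isCompact_sphere (0 : H) 1).exists_isMinOn h
      (f := fun v => inner ℝ v (M v)) (by fun_prop)
    have hu0 : u ≠ 0 := by
      rintro rfl
      simp at hu
    refine ⟨_, hM u hu0, fun v => ?_⟩
    rcases eq_or_ne v 0 with rfl | hv
    · simp
    have hv' : ‖v‖ ≠ 0 := norm_ne_zero_iff.2 hv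
    have h1 : inner ℝ u (M u) ≤ inner ℝ (‖v‖⁻¹ • v) (M (‖v‖⁻¹ • v)) :=
      hmin (show ‖v‖⁻¹ • v ∈ Metric.sphere (0 : H) 1 by
        simp [norm_smul, inv_mul_cancel₀ hv'])
    rw [map_smul, inner_smul_left, inner_smul_right] at h1
    calc _ ≤ (‖v‖⁻¹ * (‖v‖⁻¹ * inner ℝ v (M v))) * ‖v‖ ^ 2 := by gcongr; simpa using h1
      _ = _ := by field_simp

theorem inner_toEuclideanCLM {n : ℕ} (M : Matrix (Fin n) (Fin n) ℝ)
    (x y : EuclideanSpace ℝ (Fin n)) :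
    inner ℝ x (Matrix.toEuclideanCLM (𝕜 := ℝ) M y) = x.ofLp ⬝ᵥ M.mulVec y.ofLp := by
  rw [EuclideanSpace.inner_eq_star_dotProduct, Matrix.ofLp_toEuclideanCLM, dotProduct_comm]
  simp

theorem Matrix.PosDef.exists_mul_norm_sq_le_inner {n : ℕ} {M : Matrix (Fin n) (Fin n) ℝ}
    (hM : M.PosDef) :
    ∃ q > 0, ∀ v, q * ‖v‖ ^ 2 ≤ inner ℝ v (Matrix.toEuclideanCLM (𝕜 := ℝ) M v) := by
  refine _root_.exists_mul_norm_sq_le_inner _ fun v hv => ?_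
  rw [inner_toEuclideanCLM]
  simpa using hM.dotProduct_mulVec_pos (x := v.ofLp) (by simpa using hv)

theorem inner_toEuclideanCLM_comm {n : ℕ} {P : Matrix (Fin n) (Fin n) ℝ}
    (hP : P.IsHermitian) (x y : EuclideanSpace ℝ (Fin n)) :
    inner ℝ (Matrix.toEuclideanCLM (𝕜 := ℝ) P x) y =
      inner ℝ x (Matrix.toEuclideanCLM (𝕜 := ℝ) P y) := by
  have hPt : P.transpose = P := by simpa [Matrix.IsHermitian] using hP
  rw [real_inner_comm, inner_toEuclideanCLM, inner_toEuclideanCLM, Matrix.dotProduct_mulVec,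
    ← Matrix.mulVec_transpose, hPt, dotProduct_comm]

/-- The Lyapunov equation as an identity of quadratic forms. -/
theorem two_mul_inner_eq_of_lyapunov {n : ℕ} {A P Q : Matrix (Fin n) (Fin n) ℝ}
    (hP : P.IsHermitian) (hLyap : A.transpose * P + P * A = -Q) (v : EuclideanSpace ℝ (Fin n)) :
    2 * inner ℝ (Matrix.toEuclideanCLM (𝕜 := ℝ) P v) (Matrix.toEuclideanCLM (𝕜 := ℝ) A v) =
      -inner ℝ v (Matrix.toEuclideanCLM (𝕜 := ℝ) Q v) := by
  have h1 : inner ℝ (Matrix.toEuclideanCLM (𝕜 := ℝ) P v) (Matrix.toEuclideanCLM (𝕜 := ℝ) A v) =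
      v.ofLp ⬝ᵥ (P * A).mulVec v.ofLp := by
    rw [inner_toEuclideanCLM_comm hP, inner_toEuclideanCLM, Matrix.ofLp_toEuclideanCLM,
      Matrix.mulVec_mulVec]
  have h2 : inner ℝ (Matrix.toEuclideanCLM (𝕜 := ℝ) P v) (Matrix.toEuclideanCLM (𝕜 := ℝ) A v) =
      v.ofLp ⬝ᵥ (A.transpose * P).mulVec v.ofLp := by
    rw [real_inner_comm, inner_toEuclideanCLM, Matrix.ofLp_toEuclideanCLM,
      ← Matrix.mulVec_mulVec, Matrix.dotProduct_mulVec _ A.transpose, Matrix.vecMul_transpose]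
  rw [inner_toEuclideanCLM Q, ← dotProduct_neg, ← Matrix.neg_mulVec, ← hLyap, Matrix.add_mulVec,
    dotProduct_add, ← h1, ← h2, two_mul]

end Quadratic

/-- Where `r` has a right limit `l`, the reference state has the right derivative `A x_m + l B`. -/
theorem IsReferenceState.hasDerivWithinAt_Ici {n : ℕ} {A : Matrix (Fin n) (Fin n) ℝ}
    {B : Fin n → ℝ} {r : ℝ → ℝ} {xm : ℝ → EuclideanSpace ℝ (Fin n)}
    (hxm : IsReferenceState A B r xm) (hr : PiecewiseContinuous r) {t l : ℝ} (ht : 0 ≤ t)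
    (hl : Tendsto r (𝓝[>] t) (𝓝 l)) :
    HasDerivWithinAt xm (Matrix.toEuclideanCLM (𝕜 := ℝ) A (xm t) + l • WithLp.toLp 2 B)
      (Ici t) t := by
  set D := {τ : ℝ | τ ∈ Icc 0 (t + 1) ∧ ¬ ContinuousWithinAt r (Ici 0) τ}
  set S : Set ℝ := Ioo t (t + 1) \ (D \ {t}) with hS
  have hSmem : S ∈ 𝓝[>] t := by
    refine inter_mem (Ioo_mem_nhdsGT (by linarith)) (nhdsWithin_le_nhds ?_)
    exact (((hr.1 (t + 1)).subset sdiff_subset).isClosed.isOpen_compl).mem_nhds (by simp)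
  have hder : ∀ τ ∈ S, HasDerivAt xm
      (Matrix.toEuclideanCLM (𝕜 := ℝ) A (xm τ) + r τ • WithLp.toLp 2 B) τ := by
    intro τ hτ
    have h0 : 0 < τ := ht.trans_lt hτ.1.1
    have hc : ContinuousWithinAt r (Ici 0) τ := by
      by_contra hc
      exact hτ.2 ⟨⟨⟨h0.le, hτ.1.2.le⟩, hc⟩, hτ.1.1.ne'⟩
    have := (hxm.2 τ h0.le hc).hasDerivAt (Ici_mem_nhds h0)
    rwa [show WithLp.toLp 2 (A.mulVec (xm τ).ofLp + r τ • B) =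
      Matrix.toEuclideanCLM (𝕜 := ℝ) A (xm τ) + r τ • WithLp.toLp 2 B from rfl] at this
  have hct : ContinuousWithinAt xm (Ioi t) t :=
    (hxm.1 t ht).mono fun τ hτ => ht.trans (le_of_lt hτ)
  refine hasDerivWithinAt_Ici_of_tendsto_deriv (s := S)
    (fun τ hτ => (hder τ hτ).differentiableAt.differentiableWithinAt)
    (hct.mono fun τ hτ => hτ.1.1) hSmem ?_
  have hlim : Tendsto
      (fun τ => Matrix.toEuclideanCLM (𝕜 := ℝ) A (xm τ) + r τ • WithLp.toLp 2 B) (𝓝[>] t)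
      (𝓝 (Matrix.toEuclideanCLM (𝕜 := ℝ) A (xm t) + l • WithLp.toLp 2 B)) :=
    (((Matrix.toEuclideanCLM (𝕜 := ℝ) A).continuous.tendsto _).comp hct).add
      (hl.smul_const _)
  refine hlim.congr' ?_
  filter_upwards [hSmem] with τ hτ
  exact (hder τ hτ).deriv.symm

/-- A bounded reference state driven by a bounded input is Lipschitz. -/
theorem IsReferenceState.exists_norm_sub_le {n : ℕ} {A : Matrix (Fin n) (Fin n) ℝ}
    {B : Fin n → ℝ} {r : ℝ → ℝ} {xm : ℝ → EuclideanSpace ℝ (Fin n)}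
    (hxm : IsReferenceState A B r xm) (hr : PiecewiseContinuous r) (hrb : BoundedSignal r)
    (hxmb : BoundedSignal xm) :
    ∃ K, 0 ≤ K ∧ ∀ s t, 0 ≤ s → s ≤ t → ‖xm t - xm s‖ ≤ K * (t - s) := by
  obtain ⟨β, hβ⟩ := hxmb
  obtain ⟨γ, hγ⟩ := hrb
  have hβ0 : 0 ≤ β := (norm_nonneg _).trans (hβ 0 le_rfl)
  have hγ0 : 0 ≤ γ := (norm_nonneg _).trans (hγ 0 le_rfl)
  refine ⟨‖Matrix.toEuclideanCLM (𝕜 := ℝ) A‖ * β + γ * ‖WithLp.toLp 2 B‖, by positivity,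
    fun s t hs hst => ?_⟩
  have hex : ∀ τ, ∃ l : ℝ, 0 ≤ τ → Tendsto r (𝓝[>] τ) (𝓝 l) := fun τ => by
    by_cases hτ : 0 ≤ τ
    · obtain ⟨l, hl⟩ := hr.2.1 τ hτ
      exact ⟨l, fun _ => hl⟩
    · exact ⟨0, fun h => absurd h hτ⟩
  choose l hl using hex
  refine norm_image_sub_le_of_norm_deriv_right_le_segment
    (hxm.1.mono fun τ hτ => hs.trans hτ.1)
    (fun τ hτ => hxm.hasDerivWithinAt_Ici hr (hs.trans hτ.1) (hl τ (hs.trans hτ.1)))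
    (fun τ hτ => ?_) t ⟨hst, le_rfl⟩
  have hτ0 : 0 ≤ τ := hs.trans hτ.1
  have hlγ : ‖l τ‖ ≤ γ := by
    refine le_of_tendsto (hl τ hτ0).norm ?_
    filter_upwards [self_mem_nhdsWithin] with σ hσ
    exact hγ σ (hτ0.trans (le_of_lt hσ))
  refine (norm_add_le _ _).trans (add_le_add ((ContinuousLinearMap.le_opNorm _ _).trans ?_) ?_)
  · gcongr
    exact hβ τ hτ0
  · rw [norm_smul]
    gcongr

/-- Persistent excitation as a lower bound for the integrated squared projections. -/
theorem mul_norm_sq_le_integral_of_posSemidef {n : ℕ} {y : ℝ → EuclideanSpace ℝ (Fin n)}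
    {t T α : ℝ} (hT : 0 ≤ T) (hy : ContinuousOn y (Icc t (t + T)))
    (h : (excitationMatrix y t T - α • (1 : Matrix (Fin n) (Fin n) ℝ)).PosSemidef)
    (v : EuclideanSpace ℝ (Fin n)) :
    α * ‖v‖ ^ 2 ≤ ∫ τ in t..(t + T), inner ℝ (y τ) v ^ 2 := by
  have hint : ∀ i j, IntervalIntegrable (fun τ => y τ i * y τ j) MeasureTheory.volume t (t + T) := by
    intro i j
    refine ContinuousOn.intervalIntegrable ?_
    rw [uIcc_of_le (by linarith)]
    exact ((EuclideanSpace.proj i).continuous.comp_continuousOn hy).mul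
      ((EuclideanSpace.proj j).continuous.comp_continuousOn hy)
  have h1 := h.dotProduct_mulVec_nonneg v.ofLp
  have h2 : ∫ τ in t..(t + T), inner ℝ (y τ) v ^ 2 =
      v.ofLp ⬝ᵥ (excitationMatrix y t T).mulVec v.ofLp := by
    have : ∀ τ, inner ℝ (y τ) v ^ 2 = ∑ i, ∑ j, v i * v j * (y τ i * y τ j) := by
      intro τ
      simp only [PiLp.inner_apply, sq, Finset.sum_mul_sum]
      refine Finset.sum_congr rfl fun i _ => Finset.sum_congr rfl fun j _ => ?_
      simp
      ring
    simp_rw [this]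
    rw [intervalIntegral.integral_finsetSum
      fun i _ => by
        simpa only [Finset.sum_fn] using IntervalIntegrable.sum Finset.univ
          (f := fun j τ => v i * v j * (y τ i * y τ j)) fun j _ => (hint i j).const_mul _]
    simp only [dotProduct, Matrix.mulVec, excitationMatrix, Matrix.of_apply, Finset.mul_sum]
    refine Finset.sum_congr rfl fun i _ => ?_
    rw [intervalIntegral.integral_finsetSum fun j _ => (hint i j).const_mul _]
    refine Finset.sum_congr rfl fun j _ => ?_
    rw [intervalIntegral.integral_const_mul]
    ring
  rw [h2]
  simp only [star_trivial, Matrix.sub_mulVec, dotProduct_sub, Matrix.smul_mulVec,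
    Matrix.one_mulVec, dotProduct_smul, smul_eq_mul] at h1
  have h3 : ‖v‖ ^ 2 = v.ofLp ⬝ᵥ v.ofLp := by
    rw [← real_inner_self_eq_norm_sq, EuclideanSpace.inner_eq_star_dotProduct]
    simp
  rw [h3]
  linarith

/-- A persistently exciting regressor is large somewhere in every window. -/
theorem exists_le_norm_of_mul_norm_sq_le_integral {H : Type*} [NormedAddCommGroup H]
    [InnerProductSpace ℝ H] [Nontrivial H] {y : ℝ → H} {t T α ε : ℝ} (hT : 0 ≤ T)
    (hεα : ε ^ 2 * T < α) (h : ∀ v, α * ‖v‖ ^ 2 ≤ ∫ τ in t..(t + T), inner ℝ (y τ) v ^ 2) :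
    ∃ s ∈ Icc t (t + T), ε ≤ ‖y s‖ := by
  by_contra! hlt
  obtain ⟨v, hv⟩ := exists_norm_eq H zero_le_one
  have h1 := intervalIntegral.norm_integral_le_of_norm_le_const (a := t) (b := t + T)
    (f := fun τ => inner ℝ (y τ) v ^ 2) (C := ε ^ 2) fun τ hτ => by
      rw [uIoc_of_le (by linarith)] at hτ
      rw [Real.norm_of_nonneg (sq_nonneg _), ← sq_abs]
      have h2 := abs_real_inner_le_norm (y τ) v
      have h3 := hlt τ (Ioc_subset_Icc_self hτ)
      rw [hv, mul_one] at h2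
      gcongr
      linarith
  rw [add_sub_cancel_left, abs_of_nonneg hT] at h1
  have h2 := h v
  rw [hv] at h2
  have := le_abs_self (∫ τ in t..(t + T), inner ℝ (y τ) v ^ 2)
  rw [Real.norm_eq_abs] at h1
  linarith

/-- The state of a stable system can be persistently exciting only if the system has an input. -/
theorem IsReferenceState.input_ne_zero {n : ℕ} (hn : n ≠ 0) {A P Q : Matrix (Fin n) (Fin n) ℝ}
    {B : Fin n → ℝ} (hQ : Q.PosDef) (hP : P.PosDef) (hLyap : A.transpose * P + P * A = -Q)
    {r : ℝ → ℝ} {xm : ℝ → EuclideanSpace ℝ (Fin n)}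
    (hxm : IsReferenceState A B r xm) (hr : PiecewiseContinuous r) (hrb : BoundedSignal r)
    (hxmb : BoundedSignal xm) (hPE : PersistentlyExciting xm) : WithLp.toLp 2 B ≠ 0 := by
  intro hB
  have : Nonempty (Fin n) := ⟨⟨0, Nat.pos_of_ne_zero hn⟩⟩
  obtain ⟨K, hK, hLip⟩ := hxm.exists_norm_sub_le hr hrb hxmb
  obtain ⟨T, hT, α, hα, hPE⟩ := hPE
  obtain ⟨q, hq, hQq⟩ := hQ.exists_mul_norm_sq_le_inner
  obtain ⟨p, hp, hPp⟩ := hP.exists_mul_norm_sq_le_inner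
  set PL := Matrix.toEuclideanCLM (𝕜 := ℝ) P
  set u : ℝ → ℝ := fun t => inner ℝ (xm t) (PL (xm t)) with hu
  have hder : ∀ t, 0 ≤ t → HasDerivWithinAt u
      (-inner ℝ (xm t) (Matrix.toEuclideanCLM (𝕜 := ℝ) Q (xm t))) (Ici t) t := by
    intro t ht
    obtain ⟨l, hl⟩ := hr.2.1 t ht
    have h1 := hxm.hasDerivWithinAt_Ici hr ht hl
    rw [hB, smul_zero, add_zero] at h1
    have h2 := h1.inner ℝ (PL.hasFDerivAt.comp_hasDerivWithinAt t h1)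
    refine h2.congr_deriv ?_
    rw [← two_mul_inner_eq_of_lyapunov hP.isHermitian hLyap, two_mul]
    simp only [Function.comp]
    rw [← inner_toEuclideanCLM_comm hP.isHermitian, real_inner_comm (PL (xm t))]
  have hcont : ContinuousOn u (Ici 0) :=
    hxm.1.inner (𝕜 := ℝ) (PL.continuous.comp_continuousOn hxm.1)
  have hQ0 : ∀ t, -inner ℝ (xm t) (Matrix.toEuclideanCLM (𝕜 := ℝ) Q (xm t)) ≤
      -(q * ‖xm t‖ ^ 2) := fun t => neg_le_neg (hQq _)
  have hanti : AntitoneOn u (Ici 0) := by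
    intro a ha b _ hab
    have := le_sub_mul_of_deriv_right_le (c := 0) hab
      (hcont.mono fun τ hτ => le_trans ha hτ.1) (fun τ hτ => hder τ (le_trans ha hτ.1))
      (fun τ _ => (hQ0 τ).trans (by simp; positivity))
    simpa using this
  have hpos : ∀ t ∈ Ici (0 : ℝ), 0 ≤ u t := fun t _ => le_trans (by positivity) (hPp (xm t))
  set ε := √(α / (2 * T))
  have hε : 0 < ε := by positivity
  have hεα : ε ^ 2 * T < α := by
    rw [Real.sq_sqrt (by positivity)]
    field_simp
    norm_num
  set h := ε / (2 * (K + 1))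
  have hh : 0 < h := by positivity
  have hKh : K * h ≤ ε / 2 := by
    rw [show ε / 2 = (K + 1) * h by simp only [h]; field_simp]
    gcongr
    linarith
  set c := q * (ε / 2) ^ 2 * h
  have hc : 0 < c := by positivity
  obtain ⟨N, hN⟩ := exists_nat_gt (u 0 / c)
  rw [div_lt_iff₀ hc] at hN
  have hlt : u (0 + N * (T + h)) < 0 := by
    refine lt_of_decrement (c := c) (by positivity) hanti hpos (fun t ht _ => ?_) hN le_rfl
    have ht : 0 ≤ t := ht
    obtain ⟨s, hs, hεs⟩ := exists_le_norm_of_mul_norm_sq_le_integral hT.le hεα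
      (mul_norm_sq_le_integral_of_posSemidef hT.le (hxm.1.mono fun τ hτ => ht.trans hτ.1)
        (hPE t ht))
    have hs0 : 0 ≤ s := ht.trans hs.1
    have h1 : u (s + h) ≤ u s - c := le_sub_of_deriv_le_neg_mul_sq (y := xm) hq.le hK hh.le hε.le
      hKh (hcont.mono fun τ hτ => hs0.trans hτ.1) (fun τ hτ => hder τ (hs0.trans hτ.1))
      (fun τ _ => hQ0 τ) (fun τ hτ => hLip s τ hs0 hτ.1) hεs
    have h2 : u (t + (T + h)) ≤ u (s + h) := hanti (mem_Ici.2 (by linarith))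
      (mem_Ici.2 (by linarith)) (by linarith [hs.2])
    have h3 : u s ≤ u t := hanti ht hs0 hs.1
    linarith
  exact absurd (hpos (0 + N * (T + h)) (mem_Ici.2 (by positivity))) (not_le.2 hlt)

/-! ### The error dynamics -/

section ErrorDynamics

variable {n : ℕ}

/-- The tracking error `e` in `z = (e, φ)`. -/
noncomputable def trackingError :
    EuclideanSpace ℝ (Fin n ⊕ Fin n) →L[ℝ] EuclideanSpace ℝ (Fin n) :=
  LinearMap.toContinuousLinearMap
    { toFun := fun z => WithLp.toLp 2 fun i => z (Sum.inl i)
      map_add' := fun _ _ => rfl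
      map_smul' := fun _ _ => rfl }

/-- The parameter error `φ` in `z = (e, φ)`. -/
noncomputable def parameterError :
    EuclideanSpace ℝ (Fin n ⊕ Fin n) →L[ℝ] EuclideanSpace ℝ (Fin n) :=
  LinearMap.toContinuousLinearMap
    { toFun := fun z => WithLp.toLp 2 fun i => z (Sum.inr i)
      map_add' := fun _ _ => rfl
      map_smul' := fun _ _ => rfl }

theorem trackingError_apply (z : EuclideanSpace ℝ (Fin n ⊕ Fin n)) (i : Fin n) :
    trackingError z i = z (Sum.inl i) := rfl

theorem parameterError_apply (z : EuclideanSpace ℝ (Fin n ⊕ Fin n)) (i : Fin n) :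
    parameterError z i = z (Sum.inr i) := rfl

theorem norm_sq_eq_trackingError_add_parameterError (z : EuclideanSpace ℝ (Fin n ⊕ Fin n)) :
    ‖z‖ ^ 2 = ‖trackingError z‖ ^ 2 + ‖parameterError z‖ ^ 2 := by
  simp only [EuclideanSpace.norm_sq_eq, Fintype.sum_sum_type, trackingError_apply,
    parameterError_apply]

theorem norm_trackingError_le (z : EuclideanSpace ℝ (Fin n ⊕ Fin n)) :
    ‖trackingError z‖ ≤ ‖z‖ := by
  refine (sq_le_sq₀ (norm_nonneg _) (norm_nonneg _)).1 ?_
  rw [norm_sq_eq_trackingError_add_parameterError]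
  exact le_add_of_nonneg_right (sq_nonneg _)

theorem norm_parameterError_le (z : EuclideanSpace ℝ (Fin n ⊕ Fin n)) :
    ‖parameterError z‖ ≤ ‖z‖ := by
  refine (sq_le_sq₀ (norm_nonneg _) (norm_nonneg _)).1 ?_
  rw [norm_sq_eq_trackingError_add_parameterError]
  exact le_add_of_nonneg_left (sq_nonneg _)

variable (A P : Matrix (Fin n) (Fin n) ℝ) (B : Fin n → ℝ)

theorem trackingError_errorField (xm : ℝ → EuclideanSpace ℝ (Fin n))
    (z : EuclideanSpace ℝ (Fin n ⊕ Fin n)) (t : ℝ) :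
    trackingError (errorField A P B xm z t) = Matrix.toEuclideanCLM (𝕜 := ℝ) A (trackingError z) +
      inner ℝ (xm t + trackingError z) (parameterError z) • WithLp.toLp 2 B := by
  ext i
  simp [trackingError_apply, parameterError_apply, errorField, Matrix.mulVec, dotProduct,
    Matrix.fromBlocks, Matrix.vecMulVec_apply, plantState, PiLp.inner_apply,
    Matrix.ofLp_toEuclideanCLM, Finset.sum_mul]
  refine Finset.sum_congr rfl fun j _ => ?_
  ring

theorem parameterError_errorField (xm : ℝ → EuclideanSpace ℝ (Fin n))
    (z : EuclideanSpace ℝ (Fin n ⊕ Fin n)) (t : ℝ) :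
    parameterError (errorField A P B xm z t) =
      -(inner ℝ (Matrix.toEuclideanCLM (𝕜 := ℝ) P (WithLp.toLp 2 B)) (trackingError z) •
        (xm t + trackingError z)) := by
  ext i
  simp [trackingError_apply, parameterError_apply, errorField, Matrix.mulVec, dotProduct,
    Matrix.fromBlocks, Matrix.vecMulVec_apply, plantState, PiLp.inner_apply,
    Finset.sum_mul]
  simp only [← Finset.sum_neg_distrib, ← Finset.sum_add_distrib]
  refine Finset.sum_congr rfl fun j _ => ?_
  ring

/-- The error field as a function of the state and of the current value of `x_m`. -/
noncomputable def frozenErrorField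
    (p : EuclideanSpace ℝ (Fin n ⊕ Fin n) × EuclideanSpace ℝ (Fin n)) :
    EuclideanSpace ℝ (Fin n ⊕ Fin n) :=
  errorField A P B (fun _ => p.2) p.1 0

theorem errorField_eq_frozenErrorField (xm : ℝ → EuclideanSpace ℝ (Fin n))
    (z : EuclideanSpace ℝ (Fin n ⊕ Fin n)) (t : ℝ) :
    errorField A P B xm z t = frozenErrorField A P B (z, xm t) := rfl

theorem contDiff_frozenErrorField : ContDiff ℝ 1 (frozenErrorField A P B) := by
  rw [contDiff_euclidean]
  rintro (i | i)
  · have : (fun p => frozenErrorField A P B p (Sum.inl i)) = fun p =>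
        (Matrix.toEuclideanCLM (𝕜 := ℝ) A (trackingError p.1) +
          inner ℝ (p.2 + trackingError p.1) (parameterError p.1) • WithLp.toLp 2 B) i := by
      ext p
      rw [← trackingError_errorField A P B (fun _ => p.2) p.1 0]
      rfl
    rw [this]
    exact (EuclideanSpace.proj i).contDiff.comp
      (((Matrix.toEuclideanCLM (𝕜 := ℝ) A).contDiff.comp
        (trackingError.contDiff.comp contDiff_fst)).add
        (((contDiff_snd.add (trackingError.contDiff.comp contDiff_fst)).inner ℝ
          (parameterError.contDiff.comp contDiff_fst)).smul contDiff_const))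
  · have : (fun p => frozenErrorField A P B p (Sum.inr i)) = fun p =>
        (-(inner ℝ (Matrix.toEuclideanCLM (𝕜 := ℝ) P (WithLp.toLp 2 B)) (trackingError p.1) •
          (p.2 + trackingError p.1))) i := by
      ext p
      rw [← parameterError_errorField A P B (fun _ => p.2) p.1 0]
      rfl
    rw [this]
    exact (EuclideanSpace.proj i).contDiff.comp
      ((((contDiff_const.inner ℝ (trackingError.contDiff.comp contDiff_fst)).smul
        (contDiff_snd.add (trackingError.contDiff.comp contDiff_fst)))).neg)

theorem exists_lipschitzOnWith_frozenErrorField (R β : ℝ) :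
    ∃ K : NNReal, LipschitzOnWith K (frozenErrorField A P B)
      (Metric.closedBall 0 R ×ˢ Metric.closedBall 0 β) :=
  (contDiff_frozenErrorField A P B).contDiffOn.exists_lipschitzOnWith one_ne_zero
    ((convex_closedBall _ _).prod (convex_closedBall _ _))
    ((isCompact_closedBall _ _).prod (isCompact_closedBall _ _))

theorem exists_norm_frozenErrorField_le (R β : ℝ) :
    ∃ M, 0 ≤ M ∧ ∀ z w, ‖z‖ ≤ R → ‖w‖ ≤ β → ‖frozenErrorField A P B (z, w)‖ ≤ M := by
  obtain ⟨M, hM⟩ := ((isCompact_closedBall (0 : EuclideanSpace ℝ (Fin n ⊕ Fin n)) R).prod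
    (isCompact_closedBall (0 : EuclideanSpace ℝ (Fin n)) β)).exists_bound_of_continuousOn
      (contDiff_frozenErrorField A P B).continuous.continuousOn
  exact ⟨max M 0, le_max_right _ _, fun z w hz hw =>
    (hM (z, w) ⟨by simpa using hz, by simpa using hw⟩).trans (le_max_left _ _)⟩

theorem lipschitzOnBounded_errorField {xm : ℝ → EuclideanSpace ℝ (Fin n)}
    (hxmb : BoundedSignal xm) : LipschitzOnBounded (errorField A P B xm) := by
  obtain ⟨β, hβ⟩ := hxmb
  intro R
  obtain ⟨K, hK⟩ := exists_lipschitzOnWith_frozenErrorField A P B R β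
  refine ⟨K, fun t ht => LipschitzOnWith.of_dist_le_mul fun z hz w hw => ?_⟩
  have h := hK.dist_le_mul (z, xm t) ⟨hz, by simpa using hβ t ht⟩ (w, xm t)
    ⟨hw, by simpa using hβ t ht⟩
  simpa [Prod.dist_eq, errorField_eq_frozenErrorField] using h

theorem continuousOn_errorField {xm : ℝ → EuclideanSpace ℝ (Fin n)}
    (hxm : ContinuousOn xm (Ici 0)) (z : EuclideanSpace ℝ (Fin n ⊕ Fin n)) :
    ContinuousOn (errorField A P B xm z) (Ici 0) := by
  refine ContinuousOn.congr (f := fun t => frozenErrorField A P B (z, xm t)) ?_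
    fun t _ => errorField_eq_frozenErrorField A P B xm z t
  exact (contDiff_frozenErrorField A P B).continuous.comp_continuousOn (continuousOn_const.prodMk hxm)

theorem errorField_zero (xm : ℝ → EuclideanSpace ℝ (Fin n)) (t : ℝ) :
    errorField A P B xm 0 t = 0 := by
  simp [errorField]

/-- The Lyapunov function `eᵀ P e + φᵀ φ`. -/
noncomputable def lyapunovFunction (z : EuclideanSpace ℝ (Fin n ⊕ Fin n)) : ℝ :=
  inner ℝ (trackingError z) (Matrix.toEuclideanCLM (𝕜 := ℝ) P (trackingError z)) +
    ‖parameterError z‖ ^ 2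

/-- The derivative of `lyapunovFunction`. -/
noncomputable def lyapunovDeriv (z : EuclideanSpace ℝ (Fin n ⊕ Fin n)) :
    EuclideanSpace ℝ (Fin n ⊕ Fin n) →L[ℝ] ℝ :=
  (2 : ℝ) • (innerSL ℝ (Matrix.toEuclideanCLM (𝕜 := ℝ) P (trackingError z))).comp trackingError +
    (2 : ℝ) • (innerSL ℝ (parameterError z)).comp parameterError

variable {A P B}

theorem hasFDerivAt_lyapunovFunction (hP : P.IsHermitian)
    (z : EuclideanSpace ℝ (Fin n ⊕ Fin n)) :
    HasFDerivAt (lyapunovFunction P) (lyapunovDeriv P z) z := by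
  have h1 := (trackingError (n := n)).hasFDerivAt (x := z)
  have h2 := (parameterError (n := n)).hasFDerivAt (x := z)
  have h3 := (h1.inner ℝ ((Matrix.toEuclideanCLM (𝕜 := ℝ) P).hasFDerivAt.comp z h1)).add
    h2.norm_sq
  refine h3.congr_fderiv ?_
  ext w
  simp only [lyapunovDeriv, add_apply, smul_apply,
    ContinuousLinearMap.comp_apply, innerSL_apply_apply, smul_eq_mul, fderivInnerCLM_apply,
    ContinuousLinearMap.prod_apply, Function.comp_apply]
  rw [← inner_toEuclideanCLM_comm hP,
    real_inner_comm (Matrix.toEuclideanCLM (𝕜 := ℝ) P (trackingError z)), nsmul_eq_mul]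
  push_cast
  ring

/-- Along the error dynamics the derivative of the Lyapunov function is `-eᵀ Q e`. -/
theorem lyapunovDeriv_errorField {Q : Matrix (Fin n) (Fin n) ℝ} (hP : P.IsHermitian)
    (hLyap : A.transpose * P + P * A = -Q) (xm : ℝ → EuclideanSpace ℝ (Fin n))
    (z : EuclideanSpace ℝ (Fin n ⊕ Fin n)) (t : ℝ) :
    lyapunovDeriv P z (errorField A P B xm z t) =
      -inner ℝ (trackingError z) (Matrix.toEuclideanCLM (𝕜 := ℝ) Q (trackingError z)) := by
  simp only [lyapunovDeriv, add_apply, smul_apply,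
    ContinuousLinearMap.comp_apply, innerSL_apply_apply, smul_eq_mul, trackingError_errorField,
    parameterError_errorField, inner_add_right, inner_neg_right, inner_smul_right]
  rw [← two_mul_inner_eq_of_lyapunov hP hLyap, inner_toEuclideanCLM_comm hP _ (WithLp.toLp 2 B),
    real_inner_comm (trackingError z) (Matrix.toEuclideanCLM (𝕜 := ℝ) P (WithLp.toLp 2 B)),
    ← inner_add_right, real_inner_comm (xm t + trackingError z)]
  ring

theorem lyapunovFunction_le (z : EuclideanSpace ℝ (Fin n ⊕ Fin n)) :
    lyapunovFunction P z ≤ ‖Matrix.toEuclideanCLM (𝕜 := ℝ) P‖ * ‖trackingError z‖ ^ 2 +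
      ‖parameterError z‖ ^ 2 := by
  refine add_le_add_left ((real_inner_le_norm _ _).trans ?_) _
  calc _ ≤ ‖trackingError z‖ * (‖Matrix.toEuclideanCLM (𝕜 := ℝ) P‖ * ‖trackingError z‖) := by
        gcongr
        exact ContinuousLinearMap.le_opNorm _ _
    _ = _ := by ring

theorem lyapunovFunction_le_mul_norm_sq (z : EuclideanSpace ℝ (Fin n ⊕ Fin n)) :
    lyapunovFunction P z ≤ (‖Matrix.toEuclideanCLM (𝕜 := ℝ) P‖ + 1) * ‖z‖ ^ 2 := by
  refine (lyapunovFunction_le z).trans ?_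
  rw [norm_sq_eq_trackingError_add_parameterError z]
  nlinarith [mul_nonneg (norm_nonneg (Matrix.toEuclideanCLM (𝕜 := ℝ) P))
    (sq_nonneg ‖parameterError z‖), sq_nonneg ‖trackingError z‖]

theorem exists_mul_norm_sq_le_lyapunovFunction (hP : P.PosDef) :
    ∃ l > 0, ∀ z, l * ‖z‖ ^ 2 ≤ lyapunovFunction P z := by
  obtain ⟨p, hp, hPp⟩ := hP.exists_mul_norm_sq_le_inner
  refine ⟨min p 1, lt_min hp one_pos, fun z => ?_⟩
  rw [norm_sq_eq_trackingError_add_parameterError z, mul_add]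
  refine add_le_add ((mul_le_mul_of_nonneg_right (min_le_left _ _) (sq_nonneg _)).trans (hPp _))
    (mul_le_of_le_one_left (sq_nonneg _) (min_le_right _ _))

end ErrorDynamics

/-- A bound for the trajectories that start in a ball gives Lipschitz constants for these
trajectories and for their velocities. -/
theorem exists_lipschitz_errorField_solution {n : ℕ} (A P : Matrix (Fin n) (Fin n) ℝ)
    (B : Fin n → ℝ) {xm : ℝ → EuclideanSpace ℝ (Fin n)} (hxmb : BoundedSignal xm) {Kx : ℝ}
    (hLip : ∀ s t, 0 ≤ s → s ≤ t → ‖xm t - xm s‖ ≤ Kx * (t - s)) (R : ℝ) :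
    ∃ M K : ℝ, 0 ≤ M ∧ 0 ≤ K ∧ ∀ t₀, 0 ≤ t₀ → ∀ x₀ s,
      IsSolutionFrom (errorField A P B xm) t₀ x₀ s → (∀ t, t₀ ≤ t → ‖s t‖ ≤ R) →
      (∀ σ t, t₀ ≤ σ → σ ≤ t → ‖s t - s σ‖ ≤ M * (t - σ)) ∧
      ∀ σ t, t₀ ≤ σ → t₀ ≤ t →
        ‖errorField A P B xm (s t) t - errorField A P B xm (s σ) σ‖ ≤ K * |t - σ| := by
  obtain ⟨β, hβ⟩ := hxmb
  obtain ⟨M, hM0, hM⟩ := exists_norm_frozenErrorField_le A P B R β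
  obtain ⟨L, hL⟩ := exists_lipschitzOnWith_frozenErrorField A P B R β
  refine ⟨M, L * max M Kx, hM0, by positivity, fun t₀ ht₀ x₀ s hs hsR => ?_⟩
  have hsM : ∀ σ t, t₀ ≤ σ → σ ≤ t → ‖s t - s σ‖ ≤ M * (t - σ) := fun σ t hσ hσt =>
    norm_image_sub_le_of_norm_deriv_right_le_segment
      (hs.continuousOn.mono fun τ hτ => hσ.trans hτ.1)
      (fun τ hτ => hs.hasDerivWithinAt_Ici (hσ.trans hτ.1))
      (fun τ hτ => hM _ _ (hsR τ (hσ.trans hτ.1)) (hβ τ (ht₀.trans (hσ.trans hτ.1))))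
      t ⟨hσt, le_rfl⟩
  refine ⟨hsM, ?_⟩
  have key : ∀ σ t, t₀ ≤ σ → σ ≤ t →
      ‖errorField A P B xm (s t) t - errorField A P B xm (s σ) σ‖ ≤ L * max M Kx * |t - σ| := by
    intro σ t hσ hσt
    have ht := hσ.trans hσt
    have h1 := hL.norm_sub_le (x := (s t, xm t)) (y := (s σ, xm σ))
      ⟨by simpa using hsR t ht, by simpa using hβ t (ht₀.trans ht)⟩
      ⟨by simpa using hsR σ hσ, by simpa using hβ σ (ht₀.trans hσ)⟩
    rw [errorField_eq_frozenErrorField, errorField_eq_frozenErrorField, mul_assoc,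
      abs_of_nonneg (sub_nonneg.2 hσt)]
    refine h1.trans (mul_le_mul_of_nonneg_left ?_ L.2)
    have h0 : 0 ≤ t - σ := sub_nonneg.2 hσt
    rw [Prod.mk_sub_mk, Prod.norm_mk]
    refine max_le ((hsM σ t hσ hσt).trans ?_) ((hLip σ t (ht₀.trans hσ) hσt).trans ?_)
    · gcongr
      exact le_max_left _ _
    · gcongr
      exact le_max_right _ _
  intro σ t hσ ht
  rcases le_total σ t with h | h
  · exact key σ t hσ h
  · rw [norm_sub_rev, abs_sub_comm]
    exact key t σ ht h

/-- Persistent excitation makes the error dynamics uniformly attracting in the large. -/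
theorem uniformlyAttractingInTheLarge_errorField {n : ℕ} (hn : n ≠ 0)
    {A P Q : Matrix (Fin n) (Fin n) ℝ} {B : Fin n → ℝ} (hQ : Q.PosDef) (hP : P.PosDef)
    (hLyap : A.transpose * P + P * A = -Q) {r : ℝ → ℝ} (hr : PiecewiseContinuous r)
    (hrb : BoundedSignal r) {xm : ℝ → EuclideanSpace ℝ (Fin n)} (hxm : IsReferenceState A B r xm)
    (hPE : PersistentlyExciting xm) (hxmb : BoundedSignal xm) :
    UniformlyAttractingInTheLarge (errorField A P B xm) := by
  have hB := hxm.input_ne_zero hn hQ hP hLyap hr hrb hxmb hPE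
  obtain ⟨Kx, -, hLip⟩ := hxm.exists_norm_sub_le hr hrb hxmb
  obtain ⟨T, hT, α, hα, hPE⟩ := hPE
  obtain ⟨q, hq, hQq⟩ := hQ.exists_mul_norm_sq_le_inner
  obtain ⟨l, hl, hlV⟩ := exists_mul_norm_sq_le_lyapunovFunction hP
  have hV := hasFDerivAt_lyapunovFunction hP.isHermitian
  have hdecay : ∀ t z, lyapunovDeriv P z (errorField A P B xm z t) ≤
      -(q * ‖trackingError z‖ ^ 2) := fun t z => by
    rw [lyapunovDeriv_errorField hP.isHermitian hLyap]
    exact neg_le_neg (hQq _)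
  have hle : ∀ t, 0 ≤ t → ∀ z, lyapunovDeriv P z (errorField A P B xm z t) ≤ 0 := fun t _ z =>
    (hdecay t z).trans (neg_nonpos.2 (by positivity))
  intro ρ hρ η hη
  set m := ‖Matrix.toEuclideanCLM (𝕜 := ℝ) P‖ + 1 with hm
  have hm0 : 0 < m := by positivity
  set R := √(m / l) * ρ
  obtain ⟨M, K, hM0, hK0, hMK⟩ := exists_lipschitz_errorField_solution A P B hxmb hLip R
  obtain ⟨β, hβ⟩ := hxmb
  have hβ0 : 0 ≤ β := (norm_nonneg _).trans (hβ 0 le_rfl)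
  set κ := l * η ^ 2
  have hκ : 0 < κ := by positivity
  obtain ⟨ε₀, hε₀, hsmall⟩ := exists_forall_norm_parameter_le
    (Matrix.toEuclideanCLM (𝕜 := ℝ) A) hB (Matrix.toEuclideanCLM (𝕜 := ℝ) P (WithLp.toLp 2 B))
    (R := R) hT hα hK0 hβ0 (show 0 < √(κ / 4) by positivity)
  set ε := min ε₀ √(κ / (4 * m))
  have hε : 0 < ε := lt_min hε₀ (by positivity)
  have hεκ : m * ε ^ 2 ≤ κ / 4 := by
    calc m * ε ^ 2 ≤ m * √(κ / (4 * m)) ^ 2 := by gcongr; exact min_le_right _ _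
      _ = κ / 4 := by rw [Real.sq_sqrt (by positivity)]; field_simp
  set h := ε / (2 * (M + 1))
  have hh : 0 < h := by positivity
  have hMh : M * h ≤ ε / 2 := by
    rw [show ε / 2 = (M + 1) * h by simp only [h]; field_simp]
    gcongr
    linarith
  set c := q * (ε / 2) ^ 2 * h
  have hc : 0 < c := by positivity
  obtain ⟨N, hN⟩ := exists_nat_gt (m * ρ ^ 2 / c)
  rw [div_lt_iff₀ hc] at hN
  have hW : 0 < T + 1 + h := by positivity
  refine ⟨N * (T + 1 + h), by positivity, fun t₀ ht₀ x₀ s hs hx₀ t ht => ?_⟩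
  have hsR : ∀ τ, t₀ ≤ τ → ‖s τ‖ ≤ R := fun τ hτ =>
    (hs.norm_le ht₀ hV hle hl hlV lyapunovFunction_le_mul_norm_sq hτ).trans
      (mul_le_mul_of_nonneg_left hx₀ (Real.sqrt_nonneg _))
  obtain ⟨hsM, hsK⟩ := hMK t₀ ht₀ x₀ s hs hsR
  set u : ℝ → ℝ := fun t => lyapunovFunction P (s t) with hu
  have hanti : AntitoneOn u (Ici t₀) := hs.antitoneOn ht₀ hV hle
  have hcont : ContinuousOn u (Ici t₀) := fun τ hτ =>
    (hV (s τ)).continuousAt.comp_continuousWithinAt (hs.continuousOn τ hτ)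
  have hder : ∀ τ, t₀ ≤ τ → HasDerivWithinAt u
      (lyapunovDeriv P (s τ) (errorField A P B xm (s τ) τ)) (Ici τ) τ := fun τ hτ =>
    (hV (s τ)).comp_hasDerivWithinAt τ (hs.hasDerivWithinAt_Ici hτ)
  have hlt : u t < κ := by
    refine lt_of_decrement (c := c) hW hanti (fun τ _ => le_trans (by positivity) (hlV (s τ)))
      (fun a ha hκa => ?_) (lt_of_le_of_lt ?_ hN) ht
    · have ha : t₀ ≤ a := ha
      by_cases hall : ∀ τ ∈ Icc a (a + T + 1), ‖trackingError (s τ)‖ ≤ ε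
      · exfalso
        have hsub : Icc a (a + T + 1) ⊆ Ici t₀ := fun τ hτ => ha.trans hτ.1
        have hφ := hsmall ε hε (min_le_left _ _) a xm (fun τ => trackingError (s τ))
          (fun τ => parameterError (s τ))
          (fun τ => trackingError (errorField A P B xm (s τ) τ))
          (fun τ hτ => trackingError.hasFDerivAt.comp_hasDerivWithinAt τ
            ((hs.2 τ (hsub hτ)).mono hsub))
          (fun τ _ => trackingError_errorField A P B xm (s τ) τ)
          (fun σ hσ τ hτ => by
            rw [← map_sub]
            exact (norm_trackingError_le _).trans (hsK σ τ (hsub hσ) (hsub hτ)))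
          (fun τ hτ => by
            rw [← parameterError_errorField A P B xm (s τ) τ]
            exact parameterError.hasFDerivAt.comp_hasDerivWithinAt τ
              ((hs.2 τ (hsub hτ)).mono hsub))
          (fun τ hτ => hβ τ (ht₀.trans (hsub hτ)))
          (fun τ hτ => (norm_parameterError_le _).trans (hsR τ (hsub hτ))) hall
          (mul_norm_sq_le_integral_of_posSemidef hT.le
            (hxm.1.mono fun τ hτ => ht₀.trans (ha.trans hτ.1)) (hPE a (ht₀.trans ha)))
        have h1 : ‖parameterError (s a)‖ ^ 2 ≤ κ / 4 := by
          rw [← Real.sq_sqrt (show 0 ≤ κ / 4 by positivity)]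
          gcongr
        have h2 : ‖Matrix.toEuclideanCLM (𝕜 := ℝ) P‖ * ‖trackingError (s a)‖ ^ 2 ≤ m * ε ^ 2 := by
          gcongr
          · linarith
          · exact hall a ⟨le_rfl, by linarith⟩
        have h3 := lyapunovFunction_le (P := P) (s a)
        have h4 : κ ≤ lyapunovFunction P (s a) := hκa
        linarith
      · push Not at hall
        obtain ⟨σ, hσ, hεσ⟩ := hall
        have hσ0 : t₀ ≤ σ := ha.trans hσ.1
        have h1 : u (σ + h) ≤ u σ - c := le_sub_of_deriv_le_neg_mul_sq
          (y := fun τ => trackingError (s τ)) hq.le hM0 hh.le hε.le hMh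
          (hcont.mono fun τ hτ => hσ0.trans hτ.1) (fun τ hτ => hder τ (hσ0.trans hτ.1))
          (fun τ _ => hdecay τ (s τ))
          (fun τ hτ => by
            rw [← map_sub]
            exact (norm_trackingError_le _).trans (hsM σ τ hσ0 hτ.1)) hεσ.le
        have h2 : u (a + (T + 1 + h)) ≤ u (σ + h) := hanti (mem_Ici.2 (by linarith))
          (mem_Ici.2 (by linarith)) (by linarith [hσ.2])
        have h3 : u σ ≤ u a := hanti ha hσ0 hσ.1
        linarith
    · simp only [hu, hs.1]
      refine (lyapunovFunction_le_mul_norm_sq x₀).trans ?_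
      gcongr
  have h5 : l * ‖s t‖ ^ 2 ≤ l * η ^ 2 := (hlV (s t)).trans hlt.le
  exact (sq_le_sq₀ (norm_nonneg _) hη.le).1 (le_of_mul_le_mul_left h5 hl)

theorem mainTheorem4 (n : ℕ) (A P Q : Matrix (Fin n) (Fin n) ℝ) (B : Fin n → ℝ)
    (hA : IsHurwitz A) (hQ : Q.PosDef) (hP : P.PosDef)
    (hLyap : A.transpose * P + P * A = -Q)
    (r : ℝ → ℝ) (hr : PiecewiseContinuous r) (hrb : BoundedSignal r)
    (xm : ℝ → EuclideanSpace ℝ (Fin n)) (hxm : IsReferenceState A B r xm)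
    (hPE : PersistentlyExciting xm) (hxmb : BoundedSignal xm) :
    IsEquilibriumZero (errorField A P B xm) ∧
    HasTransitionFunction (errorField A P B xm) ∧
    IsUASL (errorField A P B xm) := by
  obtain ⟨l, hl, hlV⟩ := exists_mul_norm_sq_le_lyapunovFunction hP
  have hV := hasFDerivAt_lyapunovFunction hP.isHermitian
  have hle : ∀ t, 0 ≤ t → ∀ z, lyapunovDeriv P z (errorField A P B xm z t) ≤ 0 := fun t _ z => by
    obtain ⟨q, hq, hQq⟩ := hQ.exists_mul_norm_sq_le_inner
    rw [lyapunovDeriv_errorField hP.isHermitian hLyap]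
    exact neg_nonpos.2 (le_trans (by positivity) (hQq _))
  have hbound : ∀ t₀ : ℝ, 0 ≤ t₀ → ∀ x₀ s, IsSolutionFrom (errorField A P B xm) t₀ x₀ s →
      ∀ t, t₀ ≤ t → ‖s t‖ ≤ √((‖Matrix.toEuclideanCLM (𝕜 := ℝ) P‖ + 1) / l) * ‖x₀‖ :=
    fun t₀ ht₀ x₀ s hs t ht =>
      hs.norm_le ht₀ hV hle hl hlV lyapunovFunction_le_mul_norm_sq ht
  have h0 : IsEquilibriumZero (errorField A P B xm) := fun t _ => errorField_zero A P B xm t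
  refine ⟨h0, ?_, uniformlyStable_of_norm_le (Real.sqrt_nonneg _) hbound,
    uniformlyBounded_of_norm_le (Real.sqrt_nonneg _) hbound, ?_⟩
  · refine (lipschitzOnBounded_errorField A P B hxmb).hasTransitionFunction h0
      (continuousOn_errorField A P B hxm.1) hV hle fun c => ⟨√(c / l), fun z hz => ?_⟩
    refine Real.le_sqrt_of_sq_le ?_
    rw [le_div_iff₀ hl, mul_comm]
    exact (hlV z).trans hz
  · rcases eq_or_ne n 0 with rfl | hn
    · refine fun ρ _ η hη => ⟨0, le_rfl, fun t₀ _ x₀ s _ _ t _ => ?_⟩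
      rw [Subsingleton.elim (s t) 0, norm_zero]
      exact hη.le
    · exact uniformlyAttractingInTheLarge_errorField hn hQ hP hLyap hr hrb hxm hPE hxmb
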